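/- Let $(B,\mathfrak n)$ be a regular local ring of prime characteristic $p>0$ and Krull dimension $d$, and let $s>1$ be a real number. For $t\in\mathbf R$ put $$\mathcal H_t(d)=\sum_{i=0}^{\lfloor t\rfloor}\frac{(-1)^i}{d!}\binom di (t-i)^d$$ (an empty sum being $0$). For an $\mathfrak n$-primary ideal $I$ of $B$ let $I^{[p^e]}$ be the ideal generated by the $p^e$-th powers of the elements of $I$, let $\lambda$ denote length, and define the $s$-multiplicity of $I$ by $$e_s(I)=\frac{1}{\mathcal H_s(d)}\lim_{e\to\infty}\frac{\lambda\bigl(B/(I^{\lceil sp^e\rceil}+I^{[p^e]})\bigr)}{p^{ed}}.$$ Then for every integer $n\ge 1$ the limit defining $e_s(\mathfrak n^n)$ exists and $$e_s(\mathfrak n^n)=\frac{1}{\mathcal H_s(d)}\sum_{a=0}^{n-1}\binom{a+d-1}{a}\mathcal H_{sn-a}(d),$$ where $\binom{a+d-1}{a}$ is the number of monomials of degree $a$ in $d$ variables (it equals $\binom{a+d-1}{d-1}$ if $d\ge1$; if $d=0$ it is $1$ for $a=0$ and $0$ for $a\ge 1$). Moreover, $$\lim_{n\to\infty}\frac{e_s(\mathfrak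 n^n)}{n^d}=\frac{1}{d!\,\mathcal H_s(d)}.$$ -/

import Mathlib

open Filter Topology

noncomputable section

namespace SMult

/-- The normalizing factor
`H_s(d) = ∑_{i=0}^{⌊s⌋} ((-1)^i / d!) * C(d,i) * (s - i)^d` (the empty sum `0` if `s < 0`). -/
def normFactor (s : ℝ) (d : ℕ) : ℝ :=
  ∑ i ∈ Finset.range (⌊s⌋ + 1).toNat,
    (-1 : ℝ) ^ i / (d.factorial : ℝ) * (d.choose i : ℝ) * (s - i) ^ d

variable {R : Type*} [CommRing R]

/-- The ideal `J^[q]` generated by the `q`-th powers of the elements of `J`. -/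
def bracketPower (J : Ideal R) (q : ℕ) : Ideal R :=
  Ideal.span ((fun x : R => x ^ q) '' (J : Set R))

/-- The ideal `I^⌈s p^e⌉ + J^[p^e]`. -/
def mixedIdeal (p : ℕ) (s : ℝ) (I J : Ideal R) (e : ℕ) : Ideal R :=
  I ^ ⌈s * (p : ℝ) ^ e⌉₊ + bracketPower J (p ^ e)

/-- The length of `R / I` as a natural number (it is finite for the ideals of interest, those
primary to the maximal ideal of a Noetherian local ring). -/
def colength (I : Ideal R) : ℕ := (Module.length R (R ⧸ I)).toNat

variable (R) in
/-- The Krull dimension as a natural number (it is finite for a Noetherian local ring). -/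
def dimension : ℕ := ((ringKrullDim R).unbotD 0).toNat

/-- The sequence `e ↦ λ(R / (I^⌈s p^e⌉ + J^[p^e])) / p^(e d)`, where `d = dim R`. -/
def colengthSeq (p : ℕ) (s : ℝ) (I J : Ideal R) (e : ℕ) : ℝ :=
  (colength (mixedIdeal p s I J e) : ℝ) / (p : ℝ) ^ (e * dimension R)

/-- `h_s(I, J)`, the limit of `colengthSeq`. -/
def hFun (p : ℕ) (s : ℝ) (I J : Ideal R) : ℝ :=
  limUnder atTop (colengthSeq p s I J)

/-- The `s`-multiplicity `e_s(I, J) = h_s(I, J) / H_s(d)`, where `d = dim R`. -/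
def sMultiplicityPair (p : ℕ) (s : ℝ) (I J : Ideal R) : ℝ :=
  hFun p s I J / normFactor s (dimension R)

/-- `e_s(I) = e_s(I, I)`. -/
def sMultiplicity (p : ℕ) (s : ℝ) (I : Ideal R) : ℝ := sMultiplicityPair p s I I

end SMult

end

noncomputable section

namespace SMult

open IsLocalRing

/-! A regular system of parameters behaves like the variables of a polynomial ring: if S is a finite
down-closed set of exponents, the monomials outside S generate an ideal of colength |S|
(`length_quotient_monomialIdeal`). This rests on the quotients by subsets of the parameters being
domains. With q = p^e and N = ⌈sq⌉, additivity of Frobenius makes 𝔫^(nN) + (𝔫^n)^[q] a monomial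
ideal, so its colength counts the b with |b| < nN and Σ⌊b_i/q⌋ < n.

Writing b = qc + r and sorting by a = |c| gives C(a+d-1, a) choices of c, times the number of r in
{0, …, q-1}^d with |r| < nN - qa. Inclusion-exclusion on the conditions r_i < q turns that number
into an alternating sum of binomials, which divided by q^d tends to H_{sn-a}(d)
(`tendsto_boxCount_div_pow`).

For growth in n, H_t(d) = 1 once t ≥ d. As s > 1, every sn - a with a < n is eventually at least d,
and the sum collapses to C(n+d-1, d) ~ n^d/d!. -/

/-! ### Regular local rings are domains -/

theorem exists_isPrime_le_ringKrullDim_quotient {B : Type*} [CommRing B] {n : ℕ}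
    (h : (n : WithBot ℕ∞) ≤ ringKrullDim B) :
    ∃ Q : Ideal B, Q.IsPrime ∧ (n : WithBot ℕ∞) ≤ ringKrullDim (B ⧸ Q) := by
  obtain ⟨l, hl⟩ := Order.le_krullDim_iff.mp h
  refine ⟨l.head.asIdeal, l.head.isPrime, ?_⟩
  rw [ringKrullDim_quotient]
  refine Order.le_krullDim_iff.mpr ⟨⟨l.length, fun i ↦ ⟨l i, ?_⟩, fun i ↦ l.step i⟩, hl⟩
  exact LTSeries.head_le l i

theorem natCast_le_of_natCast_add_le {a b : ℕ} {x : WithBot ℕ∞}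
    (h : ((a + b : ℕ) : WithBot ℕ∞) ≤ x + (b : ℕ)) : (a : WithBot ℕ∞) ≤ x := by
  induction x using WithBot.recBotCoe with
  | bot => simp at h
  | coe x =>
    induction x using ENat.recTopCoe with
    | top => exact le_top
    | coe n =>
      have h' : a + b ≤ n + b := by exact_mod_cast h
      exact_mod_cast (by omega : a ≤ n)

theorem le_ringKrullDim_quotient_span_singleton {C : Type*} [CommRing C] [IsLocalRing C]
    [IsNoetherianRing C] {d : ℕ} {y : C} (hy : y ∈ maximalIdeal C)
    (hC : ((d + 1 : ℕ) : WithBot ℕ∞) ≤ ringKrullDim C) :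
    (d : WithBot ℕ∞) ≤ ringKrullDim (C ⧸ Ideal.span {y}) := by
  have := hC.trans (ringKrullDim_le_ringKrullDim_quotient_add_encard {y}
    (by simpa [IsLocalRing.ringJacobson_eq_maximalIdeal] using hy))
  rw [Set.encard_singleton] at this
  exact natCast_le_of_natCast_add_le (b := 1) (by exact_mod_cast this)

/-- By induction `x 0` generates a prime I. A prime Q at the bottom of a long chain is contained in
I but misses `x 0`, so Q = (x 0)Q, and Nakayama gives Q = 0. -/
theorem isDomain_of_span_eq_maximalIdeal (d : ℕ) : ∀ {B : Type*} [CommRing B] [IsLocalRing B]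
    [IsNoetherianRing B] (x : Fin d → B), Ideal.span (Set.range x) = maximalIdeal B →
    (d : WithBot ℕ∞) ≤ ringKrullDim B → IsDomain B := by
  induction d with
  | zero =>
    intro B _ _ _ x hx _
    have : IsField B := by
      rw [isField_iff_maximalIdeal_eq, ← hx]
      simp [Set.range_eq_empty]
    exact this.isDomain
  | succ d ih =>
    intro B _ _ _ x hx hd
    have hxm : ∀ i, x i ∈ maximalIdeal B := fun i ↦ hx ▸ Ideal.subset_span ⟨i, rfl⟩
    set I : Ideal B := Ideal.span {x 0} with hI
    have hIm : I ≤ maximalIdeal B := by simpa [hI, Ideal.span_le] using hxm 0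
    have : Nontrivial (B ⧸ I) := Ideal.Quotient.nontrivial_iff.mpr
      fun h ↦ (maximalIdeal.isMaximal B).ne_top (top_le_iff.mp (h ▸ hIm))
    have : IsLocalRing (B ⧸ I) := .of_surjective' (Ideal.Quotient.mk I) Ideal.Quotient.mk_surjective
    have hgen : Ideal.span (Set.range fun i : Fin d ↦ Ideal.Quotient.mk I (x i.succ)) =
        maximalIdeal (B ⧸ I) := by
      have h1 : (maximalIdeal B).map (Ideal.Quotient.mk I) = maximalIdeal (B ⧸ I) :=
        IsLocalRing.map_maximalIdeal_of_surjective _ Ideal.Quotient.mk_surjective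
      rw [← h1, ← hx, Ideal.map_span, ← Set.range_comp, Fin.range_fin_succ]
      have : (Ideal.Quotient.mk I ∘ x) 0 = 0 :=
        Ideal.Quotient.eq_zero_iff_mem.mpr (Ideal.mem_span_singleton_self (x 0))
      rw [this, Ideal.span_insert_zero]
      rfl
    have hdom : IsDomain (B ⧸ I) := ih _ hgen (le_ringKrullDim_quotient_span_singleton (hxm 0) hd)
    have hIp : I.IsPrime := (Ideal.Quotient.isDomain_iff_prime I).mp hdom
    have hle : ringKrullDim (B ⧸ I) ≤ d := by
      refine (ringKrullDim_le_spanFinrank_maximalIdeal _).trans ?_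
      rw [← hgen]
      refine Nat.cast_le.mpr ((Submodule.spanFinrank_span_le_ncard_of_finite
        (Set.finite_range _)).trans ?_)
      rw [← Set.image_univ]
      exact (Set.ncard_image_le Set.finite_univ).trans (by simp)
    obtain ⟨Q, hQ, hQd⟩ := exists_isPrime_le_ringKrullDim_quotient hd
    have hlt : ¬ ((d + 1 : ℕ) : WithBot ℕ∞) ≤ d := by
      rw [Nat.cast_le]; omega
    have hx0 : x 0 ∉ Q := by
      intro h
      have hIQ : I ≤ Q := by simpa [hI, Ideal.span_le] using h
      exact hlt (hQd.trans ((ringKrullDim_le_of_surjective (Ideal.Quotient.factor hIQ)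
        (Ideal.Quotient.factor_surjective hIQ)).trans hle))
    -- An r in Q outside I is a nonzerodivisor on the domain B/I of dimension at most d, so B/(Q +
    -- I) would have dimension below d. Cutting B/Q by the one element `x 0` leaves dimension at
    -- least d.
    have hQI : Q ≤ I := by
      intro r hr
      by_contra hrI
      have : IsLocalRing (B ⧸ Q) :=
        .of_surjective' (Ideal.Quotient.mk Q) Ideal.Quotient.mk_surjective
      have hm : Ideal.Quotient.mk Q (x 0) ∈ maximalIdeal (B ⧸ Q) := by
        rw [← IsLocalRing.map_maximalIdeal_of_surjective _ (Ideal.Quotient.mk_surjective (I := Q))]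
        exact Ideal.mem_map_of_mem _ (hxm 0)
      have h1 := le_ringKrullDim_quotient_span_singleton hm hQd
      let f : B ⧸ I →+* (B ⧸ Q) ⧸ Ideal.span {Ideal.Quotient.mk Q (x 0)} :=
        Ideal.Quotient.lift I ((Ideal.Quotient.mk _).comp (Ideal.Quotient.mk Q)) <| by
          intro a ha
          obtain ⟨c, rfl⟩ := Ideal.mem_span_singleton'.mp ha
          rw [RingHom.comp_apply, Ideal.Quotient.eq_zero_iff_mem, map_mul]
          exact Ideal.mul_mem_left _ _ (Ideal.mem_span_singleton_self _)
      have hf : Function.Surjective f := Ideal.Quotient.lift_surjective_of_surjective _ _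
        (Ideal.Quotient.mk_surjective.comp Ideal.Quotient.mk_surjective)
      have h2 := ringKrullDim_succ_le_of_surjective f hf (r := Ideal.Quotient.mk I r)
        (mem_nonZeroDivisors_of_ne_zero (by rwa [Ne, Ideal.Quotient.eq_zero_iff_mem]))
        (by simp [f, Ideal.Quotient.eq_zero_iff_mem.mpr hr])
      have h3 : (d : WithBot ℕ∞) + 1 ≤ d :=
        (add_le_add_left h1 1).trans (h2.trans hle)
      exact hlt (by exact_mod_cast h3)
    have hbot : Q = ⊥ := by
      refine Submodule.eq_bot_of_le_smul_of_le_jacobson_bot (maximalIdeal B) Q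
        (IsNoetherian.noetherian Q) ?_ (IsLocalRing.jacobson_eq_maximalIdeal ⊥ bot_ne_top).ge
      intro y hy
      obtain ⟨z, rfl⟩ := Ideal.mem_span_singleton'.mp (hQI hy)
      rw [mul_comm]
      exact Submodule.smul_mem_smul (hxm 0) ((hQ.mem_or_mem hy).resolve_right hx0)
    subst hbot
    exact (IsDomain.of_bot_isPrime B)

/-! ### Quotients by subsets of a system of parameters -/

section Parameters

variable {B : Type*} [CommRing B] [IsLocalRing B] [IsNoetherianRing B]
  {ι : Type*} [Fintype ι] [DecidableEq ι] {x : ι → B}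

theorem isPrime_span_image_of_span_eq_maximalIdeal
    (hx : Ideal.span (Set.range x) = maximalIdeal B)
    (hd : (Fintype.card ι : WithBot ℕ∞) ≤ ringKrullDim B) (T : Finset ι) :
    (Ideal.span (x '' T)).IsPrime := by
  classical
  set I := Ideal.span (x '' T) with hI
  have hxm : ∀ i, x i ∈ maximalIdeal B := fun i ↦ hx ▸ Ideal.subset_span ⟨i, rfl⟩
  have hIm : I ≤ maximalIdeal B := by
    rw [hI, Ideal.span_le]; rintro _ ⟨i, _, rfl⟩; exact hxm i
  have : Nontrivial (B ⧸ I) := Ideal.Quotient.nontrivial_iff.mpr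
      fun h ↦ (maximalIdeal.isMaximal B).ne_top (top_le_iff.mp (h ▸ hIm))
  have : IsLocalRing (B ⧸ I) := .of_surjective' (Ideal.Quotient.mk I) Ideal.Quotient.mk_surjective
  rw [← Ideal.Quotient.isDomain_iff_prime]
  have e := Tᶜ.equivFin
  refine isDomain_of_span_eq_maximalIdeal Tᶜ.card
    (fun i ↦ Ideal.Quotient.mk I (x (e.symm i))) ?_ ?_
  · rw [← IsLocalRing.map_maximalIdeal_of_surjective _ (Ideal.Quotient.mk_surjective (I := I)),
      ← hx, Ideal.map_span]
    refine le_antisymm (Ideal.span_mono ?_) (Ideal.span_le.mpr ?_)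
    · rintro _ ⟨i, rfl⟩
      exact ⟨_, ⟨_, rfl⟩, rfl⟩
    · rintro _ ⟨_, ⟨i, rfl⟩, rfl⟩
      by_cases hi : i ∈ T
      · have : Ideal.Quotient.mk I (x i) = 0 :=
          Ideal.Quotient.eq_zero_iff_mem.mpr (Ideal.subset_span ⟨i, hi, rfl⟩)
        rw [this]; exact zero_mem _
      · exact Ideal.subset_span ⟨e ⟨i, by simpa using hi⟩, by simp⟩
  · have h1 := hd.trans (ringKrullDim_le_ringKrullDim_quotient_add_card (T.image x)
      (by rw [IsLocalRing.ringJacobson_eq_maximalIdeal]; intro y hy; simp at hy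
          obtain ⟨i, _, rfl⟩ := hy; exact hxm i))
    rw [Finset.coe_image, ← hI] at h1
    have h2 : ((Tᶜ.card + T.card : ℕ) : WithBot ℕ∞) ≤ ringKrullDim (B ⧸ I) + (T.card : ℕ) := by
      rw [Finset.card_compl_add_card]
      exact h1.trans (add_le_add_right (Nat.cast_le.mpr Finset.card_image_le) _)
    exact natCast_le_of_natCast_add_le h2

/-- Otherwise `x j` would be redundant, and fewer than dim B elements would generate the maximal
ideal. -/
theorem notMem_span_image_of_span_eq_maximalIdeal
    (hx : Ideal.span (Set.range x) = maximalIdeal B)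
    (hd : (Fintype.card ι : WithBot ℕ∞) ≤ ringKrullDim B) {T : Finset ι} {j : ι} (hj : j ∉ T) :
    x j ∉ Ideal.span (x '' T) := by
  intro h
  have hm : Ideal.span (x '' (Finset.univ.erase j : Finset ι)) = maximalIdeal B := by
    rw [← hx]
    refine le_antisymm (Ideal.span_mono (Set.image_subset_range _ _)) (Ideal.span_le.mpr ?_)
    rintro _ ⟨i, rfl⟩
    by_cases hi : i = j
    · subst hi
      refine Ideal.span_mono (Set.image_mono ?_) h
      intro k hk
      simpa using fun h : k = i ↦ hj (h ▸ hk)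
    · exact Ideal.subset_span ⟨i, by simpa using hi, rfl⟩
  have h1 := hd.trans (ringKrullDim_le_spanFinrank_maximalIdeal B)
  rw [← hm, Nat.cast_le] at h1
  have h2 := h1.trans (Submodule.spanFinrank_span_le_ncard_of_finite (Set.toFinite _))
  have h3 := h2.trans (Set.ncard_image_le (Set.toFinite _))
  rw [Set.ncard_coe_finset, Finset.card_erase_of_mem (Finset.mem_univ j), Finset.card_univ] at h3
  have : 0 < Fintype.card ι := Fintype.card_pos_iff.mpr ⟨j⟩
  omega

end Parameters

/-! ### Ideals generated by powers of parameters -/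

/-- The ideal generated by the powers `x i ^ a i` for `i ∈ T`. -/
def powIdeal {B ι : Type*} [CommRing B] (x : ι → B) (a : ι → ℕ) (T : Finset ι) : Ideal B :=
  Ideal.span ((fun i ↦ x i ^ a i) '' T)

section PowIdeal

variable {B ι : Type*} [CommRing B] (x : ι → B)

theorem powIdeal_congr {a b : ι → ℕ} {T : Finset ι} (h : ∀ i ∈ T, a i = b i) :
    powIdeal x a T = powIdeal x b T := by
  rw [powIdeal, powIdeal]
  congr 1
  exact Set.image_congr fun i hi ↦ by rw [h i hi]

variable [DecidableEq ι]

theorem powIdeal_insert (a : ι → ℕ) (T : Finset ι) (i : ι) :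
    powIdeal x a (insert i T) = Ideal.span {x i ^ a i} ⊔ powIdeal x a T := by
  rw [powIdeal, Finset.coe_insert, Set.image_insert_eq, Ideal.span_insert, powIdeal]

theorem mem_powIdeal_insert {a : ι → ℕ} {T : Finset ι} {i : ι} {y : B} :
    y ∈ powIdeal x a (insert i T) ↔ ∃ c, y - c * x i ^ a i ∈ powIdeal x a T := by
  rw [powIdeal_insert, Ideal.mem_span_singleton_sup]
  constructor
  · rintro ⟨c, r, hr, rfl⟩; exact ⟨c, by simpa using hr⟩
  · rintro ⟨c, hc⟩; exact ⟨c, _, hc, by ring⟩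

/-- If distinct `x j` are nonzerodivisors modulo the ideals generated by subsets of the others, then
the same holds with the subsets replaced by powers of their elements. -/
theorem mem_powIdeal_of_mul_mem (hreg : ∀ (T : Finset ι) (j : ι), j ∉ T →
      ∀ y, x j * y ∈ Ideal.span (x '' T) → y ∈ Ideal.span (x '' T))
    (a : ι → ℕ) (T : Finset ι) (j : ι) (hj : j ∉ T) (y : B) (hy : x j * y ∈ powIdeal x a T) :
    y ∈ powIdeal x a T := by
  induction hn : ∑ i ∈ T, a i using Nat.strong_induction_on generalizing a T j y with
  | _ n ih =>
  by_cases h0 : ∃ i ∈ T, a i = 0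
  · obtain ⟨i, hi, h0⟩ := h0
    have : powIdeal x a T = ⊤ :=
      (Ideal.eq_top_iff_one _).mpr (Ideal.subset_span ⟨i, hi, by simp [h0]⟩)
    simp [this]
  by_cases h1 : ∀ i ∈ T, a i = 1
  · have : powIdeal x a T = Ideal.span (x '' T) := by
      rw [powIdeal_congr x (b := fun _ ↦ 1) h1]; simp [powIdeal]
    rw [this] at hy ⊢
    exact hreg T j hj y hy
  push Not at h0 h1
  obtain ⟨i, hi, hi1⟩ := h1
  have hi0 := h0 i hi
  obtain ⟨R, hiR, rfl⟩ : ∃ R, i ∉ R ∧ insert i R = T :=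
    ⟨T.erase i, Finset.notMem_erase _ _, Finset.insert_erase hi⟩
  rw [Finset.sum_insert hiR] at hn
  have hupd : ∀ m, powIdeal x (Function.update a i m) R = powIdeal x a R := fun m ↦
    powIdeal_congr x fun k hk ↦ Function.update_of_ne (by rintro rfl; exact hiR hk) _ _
  have hsum : ∀ m, ∑ k ∈ insert i R, Function.update a i m k = m + ∑ k ∈ R, a k := fun m ↦ by
    rw [Finset.sum_insert hiR, Function.update_self]
    congr 1
    exact Finset.sum_congr rfl fun k hk ↦
      Function.update_of_ne (by rintro rfl; exact hiR hk) _ _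
  have hmem : ∀ m z, z ∈ powIdeal x (Function.update a i m) (insert i R) ↔
      ∃ c, z - c * x i ^ m ∈ powIdeal x a R := fun m z ↦ by
    rw [mem_powIdeal_insert, hupd, Function.update_self]
  obtain ⟨c, hc⟩ := (mem_powIdeal_insert x).mp hy
  -- Induct on the total exponent. Exponent 1 at i gives y ≡ z * x i; cancelling `x i` modulo the
  -- other powers gives x j * z ≡ c * x i ^ (m + 1); exponent m + 1 then handles z.
  obtain ⟨m, hm⟩ : ∃ m, a i = m + 2 := ⟨a i - 2, by omega⟩
  obtain ⟨z, hz⟩ := (hmem 1 y).mp <| ih _ (by omega) (Function.update a i 1) _ j hj y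
    ((hmem 1 _).mpr ⟨c * x i ^ (m + 1), by rw [hm] at hc; convert hc using 1; ring⟩) (hsum 1)
  have h3 : x i * (x j * z - c * x i ^ (m + 1)) ∈ powIdeal x a R := by
    have := Ideal.sub_mem _ hc (Ideal.mul_mem_left _ (x j) hz)
    rw [hm] at this
    convert this using 1
    ring
  have h4 := ih _ (by omega) a R i hiR _ h3 rfl
  obtain ⟨w, hw⟩ := (hmem (m + 1) z).mp <| ih _ (by omega) (Function.update a i (m + 1)) _ j hj z
    ((hmem (m + 1) _).mpr ⟨c, h4⟩) (hsum (m + 1))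
  refine (mem_powIdeal_insert x).mpr ⟨w, ?_⟩
  convert Ideal.add_mem _ hz (Ideal.mul_mem_left _ (x i) hw) using 1
  rw [hm]; ring

/-- Start from 1 ∉ (x) and raise the exponents one variable at a time: x j ^ b j cancels modulo
powers of the other variables. -/
theorem prod_pow_notMem_powIdeal [Fintype ι] (hreg : ∀ (T : Finset ι) (j : ι), j ∉ T →
      ∀ y, x j * y ∈ Ideal.span (x '' T) → y ∈ Ideal.span (x '' T))
    (hx : Ideal.span (Set.range x) ≠ ⊤) (b : ι → ℕ) :
    ∏ i, x i ^ b i ∉ powIdeal x (fun i ↦ b i + 1) Finset.univ := by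
  suffices ∀ T : Finset ι, ∏ i ∈ T, x i ^ b i ∉
      powIdeal x (fun i ↦ if i ∈ T then b i + 1 else 1) Finset.univ by
    simpa using this Finset.univ
  intro T
  induction T using Finset.induction_on with
  | empty => simpa [powIdeal, ← Ideal.eq_top_iff_one] using hx
  | insert j T hj ih =>
    intro h
    apply ih
    have hpow : ∀ k a y, x j ^ k * y ∈ powIdeal x a (Finset.univ.erase j) →
        y ∈ powIdeal x a (Finset.univ.erase j) := by
      intro k
      induction k with
      | zero => simp
      | succ k ihk =>
        intro a y hy
        exact ihk a y (mem_powIdeal_of_mul_mem x hreg a _ j (Finset.notMem_erase _ _) _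
          (by convert hy using 1; ring))
    rw [← Finset.insert_erase (Finset.mem_univ j), mem_powIdeal_insert] at h ⊢
    obtain ⟨c, hc⟩ := h
    refine ⟨c, ?_⟩
    rw [powIdeal_congr x (b := fun i ↦ if i ∈ T then b i + 1 else 1)] at hc
    · refine hpow (b j) _ _ ?_
      rw [Finset.prod_insert hj] at hc
      convert hc using 1
      simp [hj]; ring
    · intro i hi
      simp [(Finset.mem_erase.mp hi).1]

end PowIdeal

theorem prod_pow_notMem_powIdeal_of_span_eq_maximalIdeal {B : Type*} [CommRing B] [IsLocalRing B]
    [IsNoetherianRing B] {ι : Type*} [Fintype ι] [DecidableEq ι] {x : ι → B}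
    (hx : Ideal.span (Set.range x) = maximalIdeal B)
    (hd : (Fintype.card ι : WithBot ℕ∞) ≤ ringKrullDim B) (b : ι → ℕ) :
    ∏ i, x i ^ b i ∉ powIdeal x (fun i ↦ b i + 1) Finset.univ :=
  prod_pow_notMem_powIdeal x (fun T _ hj _ hy ↦
    ((isPrime_span_image_of_span_eq_maximalIdeal hx hd T).mem_or_mem hy).resolve_left
      (notMem_span_image_of_span_eq_maximalIdeal hx hd hj))
    (hx ▸ (maximalIdeal.isMaximal B).ne_top) b

/-! ### Monomial ideals -/

/-- The monomial `∏ i, x i ^ b i`. -/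
def mon {B ι : Type*} [CommRing B] [Fintype ι] (x : ι → B) (b : ι → ℕ) : B := ∏ i, x i ^ b i

/-- The ideal generated by the monomials in `x` whose exponents are not in `S`. -/
def monomialIdeal {B ι : Type*} [CommRing B] [Fintype ι] (x : ι → B) (S : Set (ι → ℕ)) : Ideal B :=
  Ideal.span (mon x '' Sᶜ)

section Mon

variable {B ι : Type*} [CommRing B] [Fintype ι] (x : ι → B)

theorem mon_add (b c : ι → ℕ) : mon x (b + c) = mon x b * mon x c := by
  simp [mon, pow_add, Finset.prod_mul_distrib]

theorem mon_smul (q : ℕ) (b : ι → ℕ) : mon x (q • b) = mon x b ^ q := by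
  simp [mon, pow_mul, Finset.prod_pow, mul_comm q]

theorem mon_zero : mon x 0 = 1 := by simp [mon]

theorem mon_single [DecidableEq ι] (i : ι) : mon x (Pi.single i 1) = x i := by
  rw [mon, Finset.prod_eq_single i] <;> simp +contextual

theorem mon_mem_pow {I : Ideal B} (hx : ∀ i, x i ∈ I) (b : ι → ℕ) : mon x b ∈ I ^ ∑ i, b i := by
  rw [mon, ← Finset.prod_pow_eq_pow_sum]
  exact Ideal.prod_mem_prod fun i _ ↦ Ideal.pow_mem_pow (hx i) _

theorem mon_mem_monomialIdeal {S : Set (ι → ℕ)} {b : ι → ℕ} (hb : b ∉ S) :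
    mon x b ∈ monomialIdeal x S := Ideal.subset_span ⟨b, hb, rfl⟩

theorem mul_mon_mem_monomialIdeal [DecidableEq ι] {S : Set (ι → ℕ)} {b : ι → ℕ}
    (hb : ∀ i, b + Pi.single i 1 ∉ S) {y : B} (hy : y ∈ Ideal.span (Set.range x)) :
    y * mon x b ∈ monomialIdeal x S := by
  induction hy using Submodule.span_induction with
  | mem y hy =>
    obtain ⟨i, rfl⟩ := hy
    have := mon_mem_monomialIdeal x (hb i)
    rwa [mon_add, mon_single, mul_comm] at this
  | zero => simp
  | add y z _ _ hy hz => rw [add_mul]; exact Ideal.add_mem _ hy hz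
  | smul c y _ hy => rw [smul_eq_mul, mul_assoc]; exact Ideal.mul_mem_left _ _ hy

theorem pow_span_le_span_mon [DecidableEq ι] (n : ℕ) :
    Ideal.span (Set.range x) ^ n ≤ Ideal.span (mon x '' {b | n ≤ ∑ i, b i}) := by
  induction n with
  | zero =>
    refine le_of_le_of_eq le_top ((Ideal.eq_top_iff_one _).mpr ?_).symm
    exact Ideal.subset_span ⟨0, by simp, mon_zero x⟩
  | succ n ih =>
    rw [pow_succ]
    refine (Ideal.mul_mono_left ih).trans ?_
    rw [Ideal.span_mul_span', Ideal.span_le]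
    rintro _ ⟨_, ⟨b, hb, rfl⟩, _, ⟨i, rfl⟩, rfl⟩
    refine Ideal.subset_span ⟨b + Pi.single i 1, ?_, by simp [mon_add, mon_single]⟩
    simpa [Finset.sum_add_distrib] using hb

/-- An exponent outside a down-closed set containing b exceeds b in some coordinate. -/
theorem monomialIdeal_le_powIdeal [DecidableEq ι] {S : Set (ι → ℕ)} (hS : IsLowerSet S)
    {b : ι → ℕ} (hb : b ∈ S) :
    monomialIdeal x S ≤ powIdeal x (fun i ↦ b i + 1) Finset.univ := by
  rw [monomialIdeal, Ideal.span_le]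
  rintro _ ⟨c, hc, rfl⟩
  obtain ⟨i, hi⟩ : ∃ i, b i < c i := by
    by_contra! h
    exact hc (hS h hb)
  rw [mon, ← Finset.mul_prod_erase _ _ (Finset.mem_univ i)]
  refine Ideal.mul_mem_right _ _ ?_
  rw [← Nat.add_sub_of_le (Nat.succ_le_of_lt hi), pow_add]
  exact Ideal.mul_mem_right _ _ (Ideal.subset_span ⟨i, by simp, rfl⟩)

theorem monomialIdeal_diff_singleton {S : Set (ι → ℕ)} (b : ι → ℕ) :
    monomialIdeal x (S \ {b}) = Ideal.span {mon x b} ⊔ monomialIdeal x S := by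
  rw [monomialIdeal, monomialIdeal, ← Ideal.span_union, Set.compl_sdiff, Set.image_union,
    Set.image_singleton]

end Mon

/-! ### Colength of monomial ideals -/

section Length

variable {B : Type*} [CommRing B] [IsLocalRing B]

/-- The class of m is a nonzero socle element, so it spans a copy of the residue field in B/I. -/
theorem length_quotient_eq_one_add {I : Ideal B} {m : B} (hm : m ∉ I)
    (h : ∀ y ∈ maximalIdeal B, y * m ∈ I) :
    Module.length B (B ⧸ I) = 1 + Module.length B (B ⧸ (Ideal.span {m} ⊔ I)) := by
  let f : B →ₗ[B] B ⧸ I := LinearMap.toSpanSingleton B (B ⧸ I) (Ideal.Quotient.mk I m)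
  have hf : ∀ y, f y = Ideal.Quotient.mk I (y * m) := fun y ↦ rfl
  have hker : LinearMap.ker f = maximalIdeal B := by
    refine le_antisymm (le_maximalIdeal fun h ↦ hm ?_) fun y hy ↦ ?_
    · have : f 1 = 0 := by
        rw [← LinearMap.mem_ker, h]; trivial
      simpa [hf, Ideal.Quotient.eq_zero_iff_mem] using this
    · rw [LinearMap.mem_ker, hf, Ideal.Quotient.eq_zero_iff_mem]; exact h y hy
  have hle : I ≤ Ideal.span {m} ⊔ I := le_sup_right
  let g : (B ⧸ I) →ₗ[B] B ⧸ (Ideal.span {m} ⊔ I) := Submodule.factor hle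
  have hg : ∀ y, g (Ideal.Quotient.mk I y) = Ideal.Quotient.mk _ y := fun y ↦ rfl
  have hsimple : IsSimpleModule B (B ⧸ maximalIdeal B) :=
    isSimpleModule_iff_isCoatom.mpr (maximalIdeal.isMaximal B).out
  have h1 : Module.length B (B ⧸ LinearMap.ker f) = 1 := by
    rw [hker]; exact Module.length_eq_one _ _
  rw [Module.length_eq_add_of_exact ((LinearMap.ker f).liftQ f le_rfl) g, h1]
  · exact LinearMap.ker_eq_bot.mp (Submodule.ker_liftQ_eq_bot _ _ _ le_rfl)
  · exact Submodule.factor_surjective hle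
  · rw [LinearMap.exact_iff, Submodule.range_liftQ]
    ext z
    obtain ⟨z, rfl⟩ := Ideal.Quotient.mk_surjective z
    rw [LinearMap.mem_ker, hg, Ideal.Quotient.eq_zero_iff_mem, Ideal.mem_span_singleton_sup,
      LinearMap.mem_range]
    constructor
    · rintro ⟨a, b, hb, rfl⟩
      refine ⟨a, ?_⟩
      rw [hf, map_add, Ideal.Quotient.eq_zero_iff_mem.mpr hb, add_zero]
    · rintro ⟨a, ha⟩
      rw [hf] at ha
      exact ⟨a, z - a * m, by rw [← Ideal.Quotient.eq]; exact ha.symm, by ring⟩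

/-- Remove a maximal exponent b of S: its monomial is killed by the maximal ideal modulo the
monomial ideal, but does not lie in it. -/
theorem length_quotient_monomialIdeal [IsNoetherianRing B] {ι : Type*} [Fintype ι] [DecidableEq ι]
    {x : ι → B} (hx : Ideal.span (Set.range x) = maximalIdeal B)
    (hd : (Fintype.card ι : WithBot ℕ∞) ≤ ringKrullDim B) (S : Finset (ι → ℕ))
    (hS : IsLowerSet (S : Set (ι → ℕ))) :
    Module.length B (B ⧸ monomialIdeal x S) = S.card := by
  induction hn : S.card generalizing S with
  | zero =>
    rw [Finset.card_eq_zero] at hn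
    subst hn
    have : monomialIdeal x ((∅ : Finset (ι → ℕ)) : Set (ι → ℕ)) = ⊤ :=
      (Ideal.eq_top_iff_one _).mpr (mon_zero x ▸ mon_mem_monomialIdeal x (by simp))
    rw [this, Nat.cast_zero, Module.length_eq_zero_iff]
    exact Ideal.Quotient.subsingleton_iff.mpr rfl
  | succ n ih =>
    have hne : S.Nonempty := Finset.card_pos.mp (by omega)
    obtain ⟨b, hb⟩ := S.exists_maximal hne
    have hbS : b ∈ S := hb.1
    have hmax : ∀ c ∈ S, b ≤ c → c = b := fun c hc hbc ↦ le_antisymm (hb.2 hc hbc) hbc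
    have hlow : IsLowerSet ((S.erase b : Finset (ι → ℕ)) : Set (ι → ℕ)) := by
      intro c a hac hc
      simp only [Finset.coe_erase, Set.mem_sdiff, Set.mem_singleton_iff] at hc ⊢
      refine ⟨hS hac hc.1, ?_⟩
      rintro rfl
      exact hc.2 (hmax c hc.1 hac)
    have hstep := ih (S.erase b) hlow (by rw [Finset.card_erase_of_mem hbS]; omega)
    rw [Finset.coe_erase, monomialIdeal_diff_singleton] at hstep
    rw [length_quotient_eq_one_add (m := mon x b), hstep]
    · push_cast; ring
    · exact fun h ↦ prod_pow_notMem_powIdeal_of_span_eq_maximalIdeal hx hd b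
        (monomialIdeal_le_powIdeal x hS hbS h)
    · intro y hy
      rw [← hx] at hy
      refine mul_mon_mem_monomialIdeal x (fun i hi ↦ ?_) hy
      have := congrFun (hmax _ hi (by intro j; simp)) i
      simp at this

end Length

/-! ### The mixed ideals are monomial -/

/-- The exponents of the monomials outside `𝔫 ^ N + (𝔫 ^ n)^[q]`. -/
def mixedExponents (ι : Type*) [Fintype ι] (n N q : ℕ) : Set (ι → ℕ) :=
  {b | ∑ i, b i < N ∧ ∑ i, b i / q < n}

theorem isLowerSet_mixedExponents (ι : Type*) [Fintype ι] (n N q : ℕ) :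
    IsLowerSet (mixedExponents ι n N q) := fun _ _ h hb ↦
  ⟨(Finset.sum_le_sum fun i _ ↦ h i).trans_lt hb.1,
    (Finset.sum_le_sum fun i _ ↦ Nat.div_le_div_right (h i)).trans_lt hb.2⟩

/-- In characteristic p the map y ↦ y^q is additive, so q-th powers of monomials generate the
bracket power. A monomial x^b is divisible by some x^(qc) with |c| ≥ n exactly when Σ⌊b_i/q⌋ ≥ n. -/
theorem pow_add_bracketPower_eq_monomialIdeal {B ι : Type*} [CommRing B] [Fintype ι]
    [DecidableEq ι] (p : ℕ) [Fact p.Prime] [CharP B p] (x : ι → B) (n N e : ℕ) :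
    Ideal.span (Set.range x) ^ N + bracketPower (Ideal.span (Set.range x) ^ n) (p ^ e) =
      monomialIdeal x (mixedExponents ι n N (p ^ e)) := by
  have hq : 0 < p ^ e := pow_pos (Fact.out : p.Prime).pos e
  have hxm : ∀ i, x i ∈ Ideal.span (Set.range x) := fun i ↦ Ideal.subset_span ⟨i, rfl⟩
  apply le_antisymm
  · refine sup_le ((pow_span_le_span_mon x N).trans (Ideal.span_mono (Set.image_mono ?_))) ?_
    · intro b hb h
      exact absurd h.1 (not_lt.mpr hb)
    · rw [bracketPower, Ideal.span_le]
      rintro _ ⟨y, hy, rfl⟩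
      replace hy := pow_span_le_span_mon x n hy
      change y ^ p ^ e ∈ _
      induction hy using Submodule.span_induction with
      | mem y hy =>
        obtain ⟨b, hb, rfl⟩ := hy
        rw [← mon_smul]
        refine mon_mem_monomialIdeal x fun h ↦ absurd h.2 (not_lt.mpr ?_)
        simpa [Nat.mul_div_cancel_left _ hq] using hb
      | zero => rw [zero_pow hq.ne']; exact zero_mem _
      | add y z _ _ hy hz => rw [add_pow_char_pow]; exact Ideal.add_mem _ hy hz
      | smul c y _ hy => rw [smul_eq_mul, mul_pow]; exact Ideal.mul_mem_left _ _ hy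
  · rw [monomialIdeal, Ideal.span_le]
    rintro _ ⟨b, hb, rfl⟩
    by_cases h : N ≤ ∑ i, b i
    · exact Ideal.mem_sup_left (Ideal.pow_le_pow_right h (mon_mem_pow x hxm b))
    · have hn : n ≤ ∑ i, b i / p ^ e := by
        by_contra! h'
        exact hb ⟨not_le.mp h, h'⟩
      have hdec : b = (p ^ e) • (fun i ↦ b i / p ^ e) + fun i ↦ b i % p ^ e := by
        ext i; simp [Nat.div_add_mod]
      refine Ideal.mem_sup_right ?_
      rw [hdec, mon_add, mon_smul]
      refine Ideal.mul_mem_right _ _ (Ideal.subset_span ⟨_, ?_, rfl⟩)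
      exact Ideal.pow_le_pow_right hn (mon_mem_pow x hxm _)

theorem finite_mixedExponents (ι : Type*) [Fintype ι] (n N q : ℕ) :
    (mixedExponents ι n N q).Finite := by
  refine (Set.Finite.pi' fun _ : ι ↦ Set.finite_Iic N).subset fun b hb i ↦ ?_
  exact (Finset.single_le_sum (fun _ _ ↦ Nat.zero_le _) (Finset.mem_univ i)).trans hb.1.le

theorem colength_mixedIdeal_pow {B ι : Type*} [CommRing B] [IsLocalRing B] [IsNoetherianRing B]
    [Fintype ι] (p : ℕ) [Fact p.Prime] [CharP B p] {x : ι → B}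
    (hx : Ideal.span (Set.range x) = maximalIdeal B)
    (hd : (Fintype.card ι : WithBot ℕ∞) ≤ ringKrullDim B) (s : ℝ) (n e : ℕ) :
    colength (mixedIdeal p s (maximalIdeal B ^ n) (maximalIdeal B ^ n) e) =
      (mixedExponents ι n (n * ⌈s * (p : ℝ) ^ e⌉₊) (p ^ e)).ncard := by
  classical
  have hfin := finite_mixedExponents ι n (n * ⌈s * (p : ℝ) ^ e⌉₊) (p ^ e)
  have := length_quotient_monomialIdeal hx hd hfin.toFinset
    (by simpa using isLowerSet_mixedExponents ι n _ _)
  rw [Set.Finite.coe_toFinset, ← pow_add_bracketPower_eq_monomialIdeal p x, hx] at this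
  rw [colength, mixedIdeal, ← pow_mul, this, Set.ncard_eq_toFinset_card _ hfin]
  rfl

theorem exists_span_range_eq_maximalIdeal {B : Type*} [CommRing B] [IsRegularLocalRing B] {d : ℕ}
    (hd : ringKrullDim B = d) :
    ∃ x : Fin d → B, Ideal.span (Set.range x) = maximalIdeal B := by
  have hfg := (maximalIdeal B).fg_of_isNoetherianRing
  have h1 : (maximalIdeal B).spanFinrank = d := by
    have := IsRegularLocalRing.spanFinrank_maximalIdeal (R := B)
    rw [hd] at this
    exact_mod_cast this
  have hfin := Submodule.FG.finite_generators hfg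
  have hcard : hfin.toFinset.card = d := by
    rw [← Set.ncard_eq_toFinset_card _ hfin, Submodule.FG.generators_ncard hfg, h1]
  have e := hfin.toFinset.equivFinOfCardEq hcard
  refine ⟨fun i ↦ e.symm i, ?_⟩
  have : Set.range (fun i ↦ (e.symm i : B)) = (maximalIdeal B).generators := by
    ext y
    constructor
    · rintro ⟨i, rfl⟩
      exact hfin.mem_toFinset.mp (e.symm i).2
    · intro hy
      exact ⟨e ⟨y, hfin.mem_toFinset.mpr hy⟩, by simp⟩
  rw [this]
  exact (maximalIdeal B).span_generators

/-! ### Counting exponents -/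

/-- The number of vectors in `{0, …, q - 1}^d` with coordinate sum less than `M`. -/
def boxCount (d q M : ℕ) : ℕ := (Finset.univ.filter fun r : Fin d → Fin q ↦ ∑ i, (r i : ℕ) < M).card

/-- Stars and bars. For d = 0, truncated subtraction gives the right values: 1 at a = 0, and 0
otherwise. -/
theorem card_piAntidiag_univ_fin (d a : ℕ) :
    (Finset.piAntidiag (Finset.univ : Finset (Fin d)) a).card = (a + d - 1).choose a := by
  rw [← Finset.map_sym_eq_piAntidiag, Finset.card_map, Finset.sym_univ, Finset.card_univ,
    Sym.card_sym_eq_choose, Fintype.card_fin, add_comm]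

/-- Coordinatewise division b = qc + r. Truncation in N - q * a is harmless: both counts vanish when
N ≤ qa. -/
theorem ncard_mixedExponents {q : ℕ} (hq : 0 < q) (d n N : ℕ) :
    (mixedExponents (Fin d) n N q).ncard =
      ∑ a ∈ Finset.range n, (a + d - 1).choose a * boxCount d q (N - q * a) := by
  have hfin := finite_mixedExponents (Fin d) n N q
  have hsum : ∀ b : Fin d → ℕ, ∑ i, b i = q * ∑ i, b i / q + ∑ i, b i % q := fun b ↦ by
    rw [Finset.mul_sum, ← Finset.sum_add_distrib]
    exact Finset.sum_congr rfl fun i _ ↦ (Nat.div_add_mod _ _).symm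
  rw [Set.ncard_eq_toFinset_card _ hfin, Finset.card_eq_sum_card_fiberwise
    (f := fun b ↦ ∑ i, b i / q) (t := Finset.range n)
    (by intro b hb; simpa using (hfin.mem_toFinset.mp hb).2)]
  refine Finset.sum_congr rfl fun a ha ↦ ?_
  rw [← card_piAntidiag_univ_fin, boxCount, ← Finset.card_product]
  refine Finset.card_bij' (fun b _ ↦ (fun i ↦ b i / q, fun i ↦ ⟨b i % q, Nat.mod_lt _ hq⟩))
    (fun c _ i ↦ q * c.1 i + c.2 i) ?_ ?_ ?_ ?_
  · intro b hb
    rw [Finset.mem_filter, hfin.mem_toFinset] at hb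
    obtain ⟨⟨h1, h2⟩, h3⟩ := hb
    rw [hsum, h3] at h1
    simp only [Finset.mem_product, Finset.mem_piAntidiag, Finset.mem_filter, Finset.mem_univ,
      true_and, implies_true, and_true]
    exact ⟨h3, by omega⟩
  · intro c hc
    simp only [Finset.mem_product, Finset.mem_piAntidiag, Finset.mem_filter, Finset.mem_univ,
      true_and, implies_true, and_true] at hc
    have hdiv : ∀ i, (q * c.1 i + (c.2 i : ℕ)) / q = c.1 i := fun i ↦ by
      rw [Nat.mul_add_div hq, Nat.div_eq_of_lt (c.2 i).2, add_zero]
    have hmod : ∀ i, (q * c.1 i + (c.2 i : ℕ)) % q = c.2 i := fun i ↦ by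
      rw [Nat.mul_add_mod, Nat.mod_eq_of_lt (c.2 i).2]
    have h3 : ∑ i, (q * c.1 i + (c.2 i : ℕ)) / q = a := by
      rw [← hc.1]; exact Finset.sum_congr rfl fun i _ ↦ hdiv i
    rw [Finset.mem_filter, hfin.mem_toFinset]
    refine ⟨⟨?_, h3.trans_lt (Finset.mem_range.mp ha)⟩, h3⟩
    rw [hsum, h3, Finset.sum_congr rfl fun i _ ↦ hmod i]
    omega
  · intro b _
    ext i
    exact Nat.div_add_mod _ _
  · intro c _
    ext i
    · simp [Nat.mul_add_div hq, Nat.div_eq_of_lt (c.2 i).2]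
    · simp [Nat.mod_eq_of_lt (c.2 i).2]

theorem boxCount_zero (q : ℕ) {M : ℕ} (hM : 0 < M) : boxCount 0 q M = 1 := by
  simp [boxCount, hM]

theorem boxCount_zero_zero (q : ℕ) : boxCount 0 q 0 = 0 := by
  simp [boxCount]

theorem boxCount_succ (d q M : ℕ) :
    boxCount (d + 1) q M = ∑ r ∈ Finset.range q, boxCount d q (M - r) := by
  rw [Finset.sum_range, boxCount, Finset.card_eq_sum_card_fiberwise
    (f := fun r : Fin (d + 1) → Fin q ↦ r 0) (t := Finset.univ) (by simp)]
  refine Finset.sum_congr rfl fun k _ ↦ ?_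
  refine Finset.card_bij' (fun r _ ↦ Fin.tail r) (fun r _ ↦ Fin.cons k r) ?_ ?_ ?_ ?_
  · intro r hr
    simp only [Finset.mem_filter, Finset.mem_univ, true_and, Fin.sum_univ_succ] at hr ⊢
    obtain ⟨hr, rfl⟩ := hr
    simp only [Fin.tail]
    omega
  · intro r hr
    simp only [Finset.mem_filter, Finset.mem_univ, true_and, Fin.sum_univ_succ, Fin.cons_zero,
      Fin.cons_succ, and_true] at hr ⊢
    omega
  · intro r hr
    obtain rfl := (Finset.mem_filter.mp hr).2
    exact Fin.cons_self_tail r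
  · intro r _
    exact Fin.tail_cons _ _

/-- The number of vectors in `ℕ^d` with coordinate sum less than `u`. -/
def simplexCount (d : ℕ) : ℕ → ℕ
  | 0 => 0
  | v + 1 => (v + d).choose d

theorem simplexCount_succ (d u : ℕ) :
    simplexCount (d + 1) u = simplexCount (d + 1) (u - 1) + simplexCount d u := by
  match u with
  | 0 => simp [simplexCount]
  | 1 => simp [simplexCount]
  | v + 2 =>
    change (v + 1 + (d + 1)).choose (d + 1) = (v + (d + 1)).choose (d + 1) + (v + 1 + d).choose d
    rw [show v + 1 + (d + 1) = v + d + 1 + 1 by ring, Nat.choose_succ_succ,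
      show v + 1 + d = v + d + 1 by ring, show v + (d + 1) = v + d + 1 by ring, add_comm]

/-- For d = 0 and u = 0 the binomial would be 1 instead of 0. -/
theorem simplexCount_of_pos {d : ℕ} (hd : 0 < d) (u : ℕ) :
    simplexCount d u = (u + d - 1).choose d := by
  match u with
  | 0 => rw [simplexCount, Nat.choose_eq_zero_of_lt (by omega)]
  | v + 1 => rw [simplexCount]; congr 1; omega

theorem sum_range_simplexCount (d q M : ℕ) :
    (∑ r ∈ Finset.range q, (simplexCount d (M - r) : ℤ)) =
      simplexCount (d + 1) M - simplexCount (d + 1) (M - q) := by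
  induction q with
  | zero => simp
  | succ q ih =>
    rw [Finset.sum_range_succ, ih, simplexCount_succ d (M - q), Nat.sub_sub]
    push_cast
    ring

/-- Pascal's rule, or (1 - T)^d (1 - T) = (1 - T)^(d+1) for the shift T. -/
theorem sum_choose_mul_sub (d : ℕ) (g : ℕ → ℤ) :
    ∑ i ∈ Finset.range (d + 1), (-1 : ℤ) ^ i * d.choose i * (g i - g (i + 1)) =
      ∑ i ∈ Finset.range (d + 2), (-1 : ℤ) ^ i * (d + 1).choose i * g i := by
  have h : ∑ i ∈ Finset.range (d + 1), (-1 : ℤ) ^ i * d.choose i * g i =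
      ∑ i ∈ Finset.range (d + 1), (-1 : ℤ) ^ (i + 1) * d.choose (i + 1) * g (i + 1) + g 0 := by
    have h' := Finset.sum_range_succ' (fun i ↦ (-1 : ℤ) ^ i * d.choose i * g i) (d + 1)
    rw [Finset.sum_range_succ] at h'
    simpa using h'
  simp only [mul_sub, Finset.sum_sub_distrib, h]
  rw [Finset.sum_range_succ' _ (d + 1), add_sub_right_comm, ← Finset.sum_sub_distrib]
  congr 1
  · refine Finset.sum_congr rfl fun i _ ↦ ?_
    rw [Nat.choose_succ_succ]
    push_cast
    ring
  · simp

/-- Inclusion-exclusion over the coordinates that are at least q, proved by induction on d: summing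
over one coordinate telescopes simplex counts. -/
theorem boxCount_eq_sum (d q M : ℕ) :
    (boxCount d q M : ℤ) = ∑ i ∈ Finset.range (d + 1),
      (-1 : ℤ) ^ i * d.choose i * simplexCount d (M - q * i) := by
  induction d generalizing M with
  | zero =>
    rcases M with _ | M
    · simp [boxCount_zero_zero, simplexCount]
    · simp [boxCount_zero, simplexCount]
  | succ d ih =>
    rw [boxCount_succ, ← sum_choose_mul_sub d fun i ↦ (simplexCount (d + 1) (M - q * i) : ℤ)]
    push_cast
    simp_rw [ih]
    rw [Finset.sum_comm]
    refine Finset.sum_congr rfl fun i _ ↦ ?_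
    rw [← Finset.mul_sum, mul_add, mul_one, ← Nat.sub_sub, ← sum_range_simplexCount]
    simp_rw [Nat.sub_right_comm]

/-! ### Asymptotics and the factor H_t(d) -/

theorem tendsto_choose_div_pow (d : ℕ) {u v : ℕ → ℕ} (hv : Tendsto v atTop atTop) {τ : ℝ}
    (h : Tendsto (fun e ↦ (u e : ℝ) / v e) atTop (𝓝 τ)) :
    Tendsto (fun e ↦ ((u e + d - 1).choose d : ℝ) / (v e : ℝ) ^ d) atTop
      (𝓝 (τ ^ d / d.factorial)) := by
  have h1 : Tendsto (fun e ↦ (∏ j ∈ Finset.range d, ((u e : ℝ) / v e + (j : ℝ) / v e)) /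
      d.factorial) atTop (𝓝 ((∏ _j ∈ Finset.range d, (τ + 0)) / d.factorial)) := by
    refine (tendsto_finsetProd _ fun j _ ↦ h.add ?_).div_const _
    exact tendsto_const_nhds.div_atTop (tendsto_natCast_atTop_atTop.comp hv)
  simp only [add_zero, Finset.prod_const, Finset.card_range] at h1
  refine h1.congr fun e ↦ ?_
  have h2 : ((d.factorial * (u e + d - 1).choose d : ℕ) : ℝ) =
      ∏ j ∈ Finset.range d, ((u e : ℝ) + j) := by
    rw [← Nat.ascFactorial_eq_factorial_mul_choose', Nat.ascFactorial_eq_prod_range]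
    push_cast; rfl
  have hfac : (d.factorial : ℝ) ≠ 0 := by positivity
  simp_rw [← add_div, Finset.prod_div_distrib]
  rw [← h2, Finset.prod_const, Finset.card_range]
  push_cast
  field_simp

/-- Positive parts make the range of summation independent of t, as needed for limits. Terms with i
> t vanish only for d > 0, since 0^0 = 1. -/
theorem normFactor_eq_sum_max {t : ℝ} {d : ℕ} (hd : 0 < d) :
    normFactor t d = ∑ i ∈ Finset.range (d + 1),
      (-1 : ℝ) ^ i * d.choose i * (max (t - i) 0 ^ d / d.factorial) := by
  have h1 : normFactor t d = ∑ i ∈ Finset.range (⌊t⌋ + 1).toNat,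
      (-1 : ℝ) ^ i * d.choose i * (max (t - i) 0 ^ d / d.factorial) := by
    refine Finset.sum_congr rfl fun i hi ↦ ?_
    have hi' : (i : ℤ) ≤ ⌊t⌋ := by rw [Finset.mem_range] at hi; omega
    have : (i : ℝ) ≤ t := by exact_mod_cast Int.le_floor.mp hi'
    rw [max_eq_left (by linarith)]
    ring
  rw [h1]
  rcases le_total (⌊t⌋ + 1).toNat (d + 1) with h | h
  · refine Finset.sum_subset (Finset.range_mono h) fun i _ hi ↦ ?_
    have hi' : ⌊t⌋ < (i : ℤ) := by rw [Finset.mem_range] at hi; omega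
    have : t < i := by exact_mod_cast Int.floor_lt.mp hi'
    rw [max_eq_right (by linarith), zero_pow hd.ne']
    simp
  · refine (Finset.sum_subset (Finset.range_mono h) fun i _ hi ↦ ?_).symm
    rw [Nat.choose_eq_zero_of_lt (by rw [Finset.mem_range] at hi; omega)]
    simp

theorem normFactor_zero_right {t : ℝ} (ht : 0 ≤ t) : normFactor t 0 = 1 := by
  have : 0 ≤ ⌊t⌋ := Int.floor_nonneg.mpr ht
  rw [normFactor, show (⌊t⌋ + 1).toNat = ⌊t⌋.toNat + 1 by omega, Finset.sum_range_succ']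
  simp

/-- For t ≥ d no term is truncated, and the sum is the d-th finite difference of x^d at t - d,
divided by d!. -/
theorem normFactor_eq_one {t : ℝ} {d : ℕ} (ht : (d : ℝ) ≤ t) : normFactor t d = 1 := by
  rcases Nat.eq_zero_or_pos d with rfl | hd
  · exact normFactor_zero_right (by simpa using ht)
  have hfac : (d.factorial : ℝ) ≠ 0 := by positivity
  have h := congrFun (fwdDiff_iter_eq_factorial (R := ℝ) (n := d)) (t - d)
  rw [fwdDiff_iter_eq_sum_shift, ← Finset.sum_range_reflect] at h
  rw [normFactor_eq_sum_max hd]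
  rw [show ((d.factorial : ℝ → ℝ) (t - d)) = (d.factorial : ℝ) from rfl] at h
  refine Eq.trans ?_ ((congrArg (· / (d.factorial : ℝ)) h).trans (div_self hfac))
  simp only [Finset.sum_div]
  refine Finset.sum_congr rfl fun i hi ↦ ?_
  have hi' : i ≤ d := by rw [Finset.mem_range] at hi; omega
  have hi'' : (i : ℝ) ≤ d := by exact_mod_cast hi'
  rw [max_eq_left (by linarith), show d + 1 - 1 - i = d - i by omega, Nat.sub_sub_self hi',
    Nat.choose_symm hi', zsmul_eq_mul, nsmul_eq_mul, Nat.cast_sub hi']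
  push_cast
  ring

theorem tendsto_boxCount_div_pow (d : ℕ) {M q : ℕ → ℕ} (hq : Tendsto q atTop atTop) {t : ℝ}
    (ht : 0 < t) (h : Tendsto (fun e ↦ (M e : ℝ) / q e) atTop (𝓝 t)) :
    Tendsto (fun e ↦ (boxCount d (q e) (M e) : ℝ) / (q e : ℝ) ^ d) atTop
      (𝓝 (normFactor t d)) := by
  rcases Nat.eq_zero_or_pos d with rfl | hd
  · rw [normFactor_zero_right ht.le]
    refine tendsto_const_nhds.congr' ?_
    filter_upwards [h.eventually_const_lt ht] with e he
    have : M e ≠ 0 := by rintro h0; simp [h0] at he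
    simp [boxCount_zero _ (Nat.pos_of_ne_zero this)]
  rw [normFactor_eq_sum_max hd]
  have hlim : ∀ i : ℕ, Tendsto (fun e ↦ ((M e - q e * i : ℕ) : ℝ) / q e) atTop
      (𝓝 (max (t - i) 0)) := by
    intro i
    refine ((h.sub_const (i : ℝ)).max tendsto_const_nhds).congr' ?_
    filter_upwards [hq.eventually_gt_atTop 0] with e he
    have he' : (0 : ℝ) < q e := by exact_mod_cast he
    rcases le_total (q e * i) (M e) with hle | hle
    · have : (q e * i : ℝ) ≤ M e := by exact_mod_cast hle
      rw [max_eq_left, Nat.cast_sub hle]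
      · push_cast; field_simp
      · rw [sub_nonneg, le_div_iff₀ he']; linarith
    · have : (M e : ℝ) ≤ q e * i := by exact_mod_cast hle
      rw [max_eq_right, Nat.sub_eq_zero_of_le hle]
      · simp
      · rw [sub_nonpos, div_le_iff₀ he']; linarith
  refine (tendsto_finsetSum _ fun i _ ↦
    (tendsto_choose_div_pow d hq (hlim i)).const_mul ((-1 : ℝ) ^ i * d.choose i)).congr fun e ↦ ?_
  have hb : (boxCount d (q e) (M e) : ℝ) = ∑ i ∈ Finset.range (d + 1),
      (-1 : ℝ) ^ i * d.choose i * simplexCount d (M e - q e * i) := by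
    exact_mod_cast congrArg (Int.cast (R := ℝ)) (boxCount_eq_sum d (q e) (M e))
  rw [hb, Finset.sum_div]
  refine Finset.sum_congr rfl fun i _ ↦ ?_
  rw [simplexCount_of_pos hd]
  ring

theorem dimension_eq {B : Type*} [CommRing B] {d : ℕ} (hd : ringKrullDim B = d) :
    dimension B = d := by
  rw [dimension, hd]; rfl

theorem tendsto_ceil_sub_div (p : ℕ) (hp : 1 < p) {s : ℝ} (hs : 1 < s) {n a : ℕ} (ha : a ≤ n) :
    Tendsto (fun e : ℕ ↦ ((n * ⌈s * (p : ℝ) ^ e⌉₊ - p ^ e * a : ℕ) : ℝ) / (p ^ e : ℕ)) atTop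
      (𝓝 (s * n - a)) := by
  have hpow : Tendsto (fun e : ℕ ↦ (p : ℝ) ^ e) atTop atTop :=
    tendsto_pow_atTop_atTop_of_one_lt (by exact_mod_cast hp)
  have h1 := (tendsto_nat_ceil_mul_div_atTop (zero_le_one.trans hs.le)).comp hpow
  refine ((h1.mul_const (n : ℝ)).sub_const (a : ℝ)).congr fun e ↦ ?_
  have hq : (0 : ℝ) < (p : ℝ) ^ e := pow_pos (by exact_mod_cast (by omega : 0 < p)) e
  -- With a ≤ n, this makes the natural-number subtraction exact.
  have hle : p ^ e ≤ ⌈s * (p : ℝ) ^ e⌉₊ := by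
    have : ((p ^ e : ℕ) : ℝ) ≤ ⌈s * (p : ℝ) ^ e⌉₊ := by
      push_cast
      exact (le_mul_of_one_le_left hq.le hs.le).trans (Nat.le_ceil _)
    exact_mod_cast this
  have hle' : p ^ e * a ≤ n * ⌈s * (p : ℝ) ^ e⌉₊ := by
    rw [mul_comm]; exact Nat.mul_le_mul ha hle
  rw [Nat.cast_sub hle', Function.comp_apply]
  push_cast
  field_simp

/-! ### The multiplicity formula and its growth in n -/

theorem tendsto_colengthSeq_maximalIdeal_pow {B : Type*} [CommRing B] [IsRegularLocalRing B]
    (p : ℕ) [Fact p.Prime] [CharP B p] {d : ℕ} (hd : ringKrullDim B = d) {s : ℝ} (hs : 1 < s)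
    (n : ℕ) :
    Tendsto (colengthSeq p s (maximalIdeal B ^ n) (maximalIdeal B ^ n)) atTop
      (𝓝 (∑ a ∈ Finset.range n, ((a + d - 1).choose a : ℝ) * normFactor (s * n - a) d)) := by
  obtain ⟨x, hx⟩ := exists_span_range_eq_maximalIdeal hd
  have hp : 1 < p := (Fact.out : p.Prime).one_lt
  have hq : Tendsto (fun e ↦ p ^ e) atTop atTop := tendsto_pow_atTop_atTop_of_one_lt hp
  refine (tendsto_finsetSum _ fun a ha ↦ (tendsto_boxCount_div_pow d hq ?_
    (tendsto_ceil_sub_div p hp hs (Finset.mem_range.mp ha).le)).const_mul _).congr fun e ↦ ?_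
  · have han : (a : ℝ) < n := by exact_mod_cast Finset.mem_range.mp ha
    have : (n : ℝ) ≤ s * n := le_mul_of_one_le_left (Nat.cast_nonneg n) hs.le
    linarith
  · rw [colengthSeq, dimension_eq hd, colength_mixedIdeal_pow p hx (by rw [Fintype.card_fin, hd]),
      ncard_mixedExponents (pow_pos (by omega) e), pow_mul, Nat.cast_sum, Finset.sum_div]
    refine Finset.sum_congr rfl fun a _ ↦ ?_
    push_cast
    ring

theorem sMultiplicity_maximalIdeal_pow {B : Type*} [CommRing B] [IsRegularLocalRing B]
    (p : ℕ) [Fact p.Prime] [CharP B p] {d : ℕ} (hd : ringKrullDim B = d) {s : ℝ} (hs : 1 < s)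
    (n : ℕ) :
    sMultiplicity p s (maximalIdeal B ^ n) =
      (∑ a ∈ Finset.range n, ((a + d - 1).choose a : ℝ) * normFactor (s * n - a) d) /
        normFactor s d := by
  rw [sMultiplicity, sMultiplicityPair, hFun, dimension_eq hd,
    (tendsto_colengthSeq_maximalIdeal_pow p hd hs n).limUnder_eq]

theorem tendsto_sum_choose_mul_normFactor_div_pow (d : ℕ) {s : ℝ} (hs : 1 < s) :
    Tendsto (fun n : ℕ ↦ (∑ a ∈ Finset.range n, ((a + d - 1).choose a : ℝ) *
      normFactor (s * n - a) d) / (n : ℝ) ^ d) atTop (𝓝 (1 / d.factorial)) := by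
  have h1 : Tendsto (fun n : ℕ ↦ (n : ℝ) / n) atTop (𝓝 1) := by
    refine tendsto_const_nhds.congr' ?_
    filter_upwards [eventually_gt_atTop 0] with n hn
    rw [div_self (by positivity)]
  have h2 := tendsto_choose_div_pow d tendsto_id h1
  rw [one_pow] at h2
  have h3 : Tendsto (fun n : ℕ ↦ (s - 1) * (n : ℝ)) atTop atTop :=
    tendsto_natCast_atTop_atTop.const_mul_atTop (by linarith)
  refine h2.congr' ?_
  -- For a < n, sn - a ≥ (s - 1)n ≥ d, so every normalizing factor in the sum is 1; the hockey-stick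
  -- identity sums the rest.
  filter_upwards [eventually_gt_atTop 0, h3.eventually_ge_atTop (d : ℝ)] with n hn hnd
  have hone : ∀ a ∈ Finset.range n, ((a + d - 1).choose a : ℝ) * normFactor (s * n - a) d =
      (d.multichoose a : ℕ) := by
    intro a ha
    have han : (a : ℝ) ≤ n := by exact_mod_cast (Finset.mem_range.mp ha).le
    rw [normFactor_eq_one (by linarith), mul_one, Nat.multichoose_eq, add_comm]
  obtain ⟨m, rfl⟩ : ∃ m, n = m + 1 := ⟨n - 1, by omega⟩
  rw [Finset.sum_congr rfl hone, ← Nat.cast_sum, Nat.sum_range_multichoose]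
  simp only [id]
  rw [show m + 1 + d - 1 = m + d by omega]

end SMult

end

theorem mainTheorem12 {B : Type*} [CommRing B] [IsRegularLocalRing B]
    (p : ℕ) [Fact p.Prime] [CharP B p]
    (d : ℕ) (hd : ringKrullDim B = d) (s : ℝ) (hs : 1 < s) :
    -- the limits defining the multiplicities exist, and the multiplicities are given explicitly;
    -- `C(a+d-1, a)` is `C(a+d-1, d-1)` for `d ≥ 1`, and has the right value also for `d = 0`
    (∀ n : ℕ, 1 ≤ n →
      (∃ h : ℝ, Tendsto (SMult.colengthSeq p s (IsLocalRing.maximalIdeal B ^ n)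
          (IsLocalRing.maximalIdeal B ^ n)) atTop (𝓝 h)) ∧
      SMult.sMultiplicity p s (IsLocalRing.maximalIdeal B ^ n) =
        (∑ a ∈ Finset.range n,
          ((a + d - 1).choose a : ℝ) * SMult.normFactor (s * n - a) d) /
            SMult.normFactor s d) ∧
    Tendsto (fun n : ℕ => SMult.sMultiplicity p s (IsLocalRing.maximalIdeal B ^ n) / (n : ℝ) ^ d)
      atTop (𝓝 (1 / ((d.factorial : ℝ) * SMult.normFactor s d))) := by
  refine ⟨fun n _ ↦ ⟨⟨_, SMult.tendsto_colengthSeq_maximalIdeal_pow p hd hs n⟩,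
    SMult.sMultiplicity_maximalIdeal_pow p hd hs n⟩, ?_⟩
  rw [← div_div]
  refine ((SMult.tendsto_sum_choose_mul_normFactor_div_pow d hs).div_const _).congr fun n ↦ ?_
  rw [SMult.sMultiplicity_maximalIdeal_pow p hd hs n, div_right_comm]
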